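/- Quantum query model. For $n,k\ge 1$ order the grid $[n]^k=\{1,\dots,n\}^k$ coordinatewise, and fix an injective binary representation $e:[n]^k\to\{0,1\}^b$ of its points. A $T$-query quantum algorithm has a finite workspace set $W$ and basis states $|i,a,z\rangle$ with $i\in[n]^k$, $a\in\{0,1\}^b$, $z\in W$. On an input $f:[n]^k\to[n]^k$ it starts from a fixed unit vector and applies $U_0,\mathcal O_f,U_1,\mathcal O_f,\dots,U_{T-1},\mathcal O_f,U_T$, where the $U_t$ are arbitrary unitary operators that do not depend on $f$ and $\mathcal O_f|i,a,z\rangle=|i,a\oplus e(f(i)),z\rangle$ ($\oplus$ is bitwise exclusive or). It then measures all the registers and outputs a point of $[n]^k$ that is a fixed function of the outcome. The bounded-error quantum query complexity of $\mathrm{TARSKI}(n,k)$ is the minimum $T$ for which some $T$-query quantum algorithm outputs, on every monotone $f:[n]^k\to[n]^k$, a fixed point of $f$ with probability at least $2/3$. Corollary 2. For all $k\ge 2$, the bounded-error quantum query complexity of $\mathrm{TARSKI}(n,k)$ is $\Omega((\log n)^2)$, uniformly in $k$: there are an absolute constant $c>0$ and an $N\in\mathbb N$ such that for all $k\ge 2$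 and all $n\ge N$, and for every injective binary representation of the grid points, it is at least $c(\log n)^2$. -/

import Mathlib

open scoped ENNReal

/-- A quantum query algorithm. The input is a string indexed by the finite set `ι`, whose
characters are represented by `b` bits; the outputs lie in `H`. The basis states are the triples
`(i, a, z)`, with `i` the index register, `a` the answer register and `z` the workspace register.
The algorithm applies `U 0`, query, `U 1`, query, ..., query, `U queries` to the initial state
(the matrices `U t` with `queries < t` play no role), measures all the registers, and
outputs `out` of the triple that it has measured. -/
structure QueryAlgorithm (ι : Type) [Fintype ι] [DecidableEq ι] (b : ℕ) (H : Type) where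
  /-- The values of the workspace register. -/
  W : Type
  [fintypeW : Fintype W]
  [decEqW : DecidableEq W]
  /-- The number of queries. -/
  queries : ℕ
  /-- The amplitudes of the initial state. -/
  init : ι × (Fin b → Bool) × W → ℂ
  init_norm : ∑ x, ‖init x‖ ^ 2 = 1
  /-- The unitary matrices that are applied before, between and after the queries. -/
  U : ℕ → Matrix.unitaryGroup (ι × (Fin b → Bool) × W) ℂ
  /-- The output, as a function of the outcome of the final measurement. -/
  out : ι × (Fin b → Bool) × W → H

attribute [instance] QueryAlgorithm.fintypeW QueryAlgorithm.decEqW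

/-- Bitwise exclusive or. -/
def bitXor {b : ℕ} (u v : Fin b → Bool) : Fin b → Bool := fun j => xor (u j) (v j)

/-- The query to the bit representation `s` of the input string: the linear map that sends the
basis state `|i, a, z⟩` to `|i, a ⊕ s i, z⟩`. As `⊕ s i` is an involution, the amplitude of
`|i, a, z⟩` after the query is that of `|i, a ⊕ s i, z⟩` before it. -/
def oracle {ι : Type} {b : ℕ} {W : Type} (s : ι → Fin b → Bool)
    (φ : ι × (Fin b → Bool) × W → ℂ) : ι × (Fin b → Bool) × W → ℂ :=
  fun x => φ (x.1, bitXor x.2.1 (s x.1), x.2.2)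

/-- The effect of a query on the basis states. -/
theorem oracle_single {ι : Type} [DecidableEq ι] {b : ℕ} {W : Type} [DecidableEq W]
    (s : ι → Fin b → Bool) (i : ι) (a : Fin b → Bool) (z : W) :
    oracle s (Pi.single (i, a, z) (1 : ℂ)) = Pi.single (i, bitXor a (s i), z) 1 := by
  have hx : ∀ u v : Fin b → Bool, bitXor (bitXor u v) v = u := fun u v => by
    funext j; simp [bitXor]
  funext ⟨i', a', z'⟩
  simp only [oracle, Pi.single_apply, Prod.mk.injEq]
  congr 1
  apply propext
  constructor
  · rintro ⟨rfl, h, rfl⟩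
    exact ⟨rfl, by rw [← h, hx], rfl⟩
  · rintro ⟨rfl, h, rfl⟩
    exact ⟨rfl, by rw [h, hx], rfl⟩

namespace QueryAlgorithm

variable {ι : Type} [Fintype ι] [DecidableEq ι] {b : ℕ} {H : Type}

/-- The state of the algorithm after `t` queries and the unitary step that follows them. -/
def state (A : QueryAlgorithm ι b H) (s : ι → Fin b → Bool) :
    ℕ → ι × (Fin b → Bool) × A.W → ℂ
  | 0 => (A.U 0).1.mulVec A.init
  | t + 1 => (A.U (t + 1)).1.mulVec (oracle s (A.state s t))

open Classical in
/-- The probability that the output of the algorithm lies in `Y`. -/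
noncomputable def prob (A : QueryAlgorithm ι b H) (s : ι → Fin b → Bool) (Y : Set H) : ℝ :=
  ∑ x, if A.out x ∈ Y then ‖A.state s A.queries x‖ ^ 2 else 0

/-- On every input string `s ∈ S`, presented through the binary representation `enc` of the
alphabet `G`, the algorithm gives an answer in the set `R s` of correct answers with probability
at least `2 / 3`. -/
def Succeeds {G : Type} (A : QueryAlgorithm ι b H) (enc : G ↪ (Fin b → Bool))
    (S : Set (ι → G)) (R : (ι → G) → Set H) : Prop :=
  ∀ s ∈ S, 2 / 3 ≤ A.prob (fun i => enc (s i)) (R s)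

end QueryAlgorithm

/-- The bounded-error quantum query complexity of a search problem: the minimum number of queries
of a quantum algorithm that succeeds on every input. -/
noncomputable def quantumQueryComplexity {ι : Type} [Fintype ι] [DecidableEq ι] {b : ℕ}
    {G H : Type} (enc : G ↪ (Fin b → Bool)) (S : Set (ι → G)) (R : (ι → G) → Set H) : ℕ∞ :=
  ⨅ (A : QueryAlgorithm ι b H) (_ : A.Succeeds enc S R), (A.queries : ℕ∞)

/-- The grid `[n]^k` with the coordinatewise order; `Fin n` is the chain with `n` elements. -/
abbrev Grid (n k : ℕ) : Type := Fin k → Fin n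

/-- The bounded-error quantum query complexity of the problem to find a fixed point of an unknown
monotone self-map of the grid `[n]^k`, with the grid points represented in binary by `enc`. -/
noncomputable def tarskiQueryComplexity (n k : ℕ) {b : ℕ}
    (enc : Grid n k ↪ (Fin b → Bool)) : ℕ∞ :=
  quantumQueryComplexity enc {f : Grid n k → Grid n k | Monotone f}
    (fun f => Function.fixedPoints f)

/-! ### Inner products of states and the effect of one query -/

open scoped Matrix

/-! The proof is a positive-weight adversary argument on a family of planar inputs. A herringbone
map sends points off a monotone staircase back towards it, and points on it along it towards a
single fixed point. Hidden are the strip of the fixed point among `4 ^ L` strips and, independently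
in every strip, the offsets of a vertical and a horizontal segment. A query tells on which side of
its strip the fixed point lies only if it hits the staircase there. So an ordered search over strips
is composed with an ordered search over offsets; each costs order `L`, and together they cost order
`L ^ 2`, where `L` is about `log n`.

The adversary matrix `HiddenStair.kernel` multiplies a multiscale kernel on the strips by transition
probabilities that resample, with the same kernel normalised, just the offsets between the two fixed
points. Its row sums are at least `3 / 4 * L` (`sum_kernel_ge`). A query can separate two inputs
only if, in one of its two coordinates, its strip lies between the two fixed-point strips and its
offset between the two hidden offsets (`image_eq_of_not_detects`). Either betweenness condition cuts
the Schur bound of the multiscale kernel from `L + 1` to `3` (`sum_blockKernelAt_mul_le`), so the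
part seen by a query has quadratic form at most `2 * 3 * 3 / (L + 1)` (`quadraticForm_gridMap_le`).
`sum_le_of_quadraticForm_le` turns the ratio of the two bounds into a number of queries. -/

/-- The real part of the inner product of two complex vectors. -/
noncomputable def reInner {κ : Type} [Fintype κ] (φ χ : κ → ℂ) : ℝ := (star φ ⬝ᵥ χ).re

theorem reInner_eq_sum {κ : Type} [Fintype κ] (φ χ : κ → ℂ) :
    reInner φ χ = ∑ x, (star (φ x) * χ x).re := by
  simp [reInner, dotProduct]

theorem reInner_self {κ : Type} [Fintype κ] (φ : κ → ℂ) : reInner φ φ = ∑ x, ‖φ x‖ ^ 2 := by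
  rw [reInner_eq_sum]
  refine Finset.sum_congr rfl fun x _ => ?_
  rw [← Complex.normSq_eq_norm_sq, Complex.normSq_apply]
  simp

theorem reInner_mulVec {κ : Type} [Fintype κ] [DecidableEq κ] (U : Matrix.unitaryGroup κ ℂ)
    (φ χ : κ → ℂ) : reInner (U.1.mulVec φ) (U.1.mulVec χ) = reInner φ χ := by
  have hU : U.1ᴴ * U.1 = 1 := Matrix.mem_unitaryGroup_iff'.1 U.2
  unfold reInner
  rw [Matrix.star_mulVec, Matrix.dotProduct_mulVec, Matrix.vecMul_vecMul, hU, Matrix.vecMul_one]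

theorem re_star_mul_le (u v : ℂ) : (star u * v).re ≤ ‖u‖ * ‖v‖ := by
  refine (Complex.re_le_norm _).trans ?_
  rw [norm_mul, norm_star]

theorem neg_re_star_mul_le (u v : ℂ) : -(star u * v).re ≤ ‖u‖ * ‖v‖ := by
  have := re_star_mul_le (-u) v
  simpa using this

theorem bitXor_bitXor {b : ℕ} (u v : Fin b → Bool) : bitXor (bitXor u v) v = u := by
  funext j; simp [bitXor]

/-- Bitwise exclusive or with a fixed string, as a permutation. -/
def bitXorEquiv {b : ℕ} (v : Fin b → Bool) : Equiv.Perm (Fin b → Bool) where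
  toFun u := bitXor u v
  invFun u := bitXor u v
  left_inv u := bitXor_bitXor u v
  right_inv u := bitXor_bitXor u v

section Oracle

variable {ι : Type} {b : ℕ} {W : Type} [Fintype W]

theorem sum_oracle_fiber {M : Type} [AddCommMonoid M] (v : Fin b → Bool)
    (F : (Fin b → Bool) × W → M) :
    ∑ p : (Fin b → Bool) × W, F (bitXor p.1 v, p.2) = ∑ p, F p :=
  Equiv.sum_comp ((bitXorEquiv v).prodCongr (Equiv.refl W)) F

theorem reInner_oracle_self [Fintype ι] (s : ι → Fin b → Bool) (φ : ι × (Fin b → Bool) × W → ℂ) :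
    reInner (oracle s φ) (oracle s φ) = reInner φ φ := by
  rw [reInner_self, reInner_self, Fintype.sum_prod_type, Fintype.sum_prod_type]
  exact Finset.sum_congr rfl fun i _ => sum_oracle_fiber (s i) fun p => ‖φ (i, p)‖ ^ 2

/-- The norm of the part of a state whose index register holds `i`. -/
noncomputable def indexNorm (φ : ι × (Fin b → Bool) × W → ℂ) (i : ι) : ℝ :=
  √(∑ p, ‖φ (i, p)‖ ^ 2)

theorem indexNorm_sq (φ : ι × (Fin b → Bool) × W → ℂ) (i : ι) :
    indexNorm φ i ^ 2 = ∑ p, ‖φ (i, p)‖ ^ 2 :=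
  Real.sq_sqrt (Finset.sum_nonneg fun _ _ => by positivity)

theorem sum_indexNorm_sq [Fintype ι] (φ : ι × (Fin b → Bool) × W → ℂ) :
    ∑ i, indexNorm φ i ^ 2 = reInner φ φ := by
  rw [reInner_self, Fintype.sum_prod_type]
  exact Finset.sum_congr rfl fun i _ => indexNorm_sq φ i

theorem sum_norm_mul_norm_le (φ χ : ι × (Fin b → Bool) × W → ℂ) (i : ι) :
    ∑ p, ‖φ (i, p)‖ * ‖χ (i, p)‖ ≤ indexNorm φ i * indexNorm χ i :=
  Real.sum_mul_le_sqrt_mul_sqrt _ _ _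

theorem indexNorm_oracle (s : ι → Fin b → Bool) (φ : ι × (Fin b → Bool) × W → ℂ) (i : ι) :
    indexNorm (oracle s φ) i = indexNorm φ i := by
  unfold indexNorm
  congr 1
  exact sum_oracle_fiber (s i) fun p => ‖φ (i, p)‖ ^ 2

/-- A query changes the inner product of two states only through the indices at which the two
inputs differ. -/
theorem reInner_sub_reInner_oracle_le [Fintype ι] (s t : ι → Fin b → Bool)
    (φ χ : ι × (Fin b → Bool) × W → ℂ) :
    reInner φ χ - reInner (oracle s φ) (oracle t χ) ≤
      2 * ∑ i, if s i = t i then 0 else indexNorm φ i * indexNorm χ i := by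
  rw [reInner_eq_sum, reInner_eq_sum, Fintype.sum_prod_type, Fintype.sum_prod_type,
    ← Finset.sum_sub_distrib, Finset.mul_sum]
  refine Finset.sum_le_sum fun i _ => ?_
  split_ifs with h
  · have := sum_oracle_fiber (s i) fun p => (star (φ (i, p)) * χ (i, p)).re
    have h2 : ∀ p : (Fin b → Bool) × W, (star (oracle s φ (i, p)) * oracle t χ (i, p)).re =
        (star (φ (i, (bitXor p.1 (s i), p.2))) * χ (i, (bitXor p.1 (s i), p.2))).re := by
      intro p; simp [oracle, h]
    rw [Finset.sum_congr rfl fun p _ => h2 p, this]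
    simp
  · have h1 : ∑ p, (star (φ (i, p)) * χ (i, p)).re ≤ indexNorm φ i * indexNorm χ i :=
      (Finset.sum_le_sum fun p _ => re_star_mul_le _ _).trans (sum_norm_mul_norm_le φ χ i)
    have h2 : -∑ p, (star (oracle s φ (i, p)) * oracle t χ (i, p)).re ≤
        indexNorm φ i * indexNorm χ i := by
      rw [← Finset.sum_neg_distrib, ← indexNorm_oracle s φ, ← indexNorm_oracle t χ]
      exact (Finset.sum_le_sum fun p _ => neg_re_star_mul_le _ _).trans
        (sum_norm_mul_norm_le _ _ i)
    linarith

end Oracle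

open Classical in
/-- Two unit vectors whose measurements are likely to fall into disjoint sets have a small inner
product. -/
theorem reInner_le_of_disjoint {κ H : Type} [Fintype κ] (out : κ → H) (φ χ : κ → ℂ)
    (hφ : reInner φ φ = 1) (hχ : reInner χ χ = 1) {Y Z : Set H} (hYZ : Disjoint Y Z)
    (hY : 2 / 3 ≤ ∑ x, if out x ∈ Y then ‖φ x‖ ^ 2 else 0)
    (hZ : 2 / 3 ≤ ∑ x, if out x ∈ Z then ‖χ x‖ ^ 2 else 0) :
    reInner φ χ ≤ 17 / 18 := by
  -- On `Y` or on `Z` the coefficients become `3 / 8` and `2 / 3`, whose product is `1 / 4`, so this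
  -- is exactly AM-GM. Summed up: `4 / 3 - 7 / 24 * (4 / 3) = 17 / 18`.
  have key : ∀ x, (star (φ x) * χ x).re ≤
      (2 / 3) * ‖φ x‖ ^ 2 + (2 / 3) * ‖χ x‖ ^ 2
        - (7 / 24) * (if out x ∈ Y then ‖φ x‖ ^ 2 else 0)
        - (7 / 24) * (if out x ∈ Z then ‖χ x‖ ^ 2 else 0) := by
    intro x
    refine (re_star_mul_le _ _).trans ?_
    have hn : out x ∈ Y → out x ∉ Z := fun h h' => Set.disjoint_left.1 hYZ h h'
    split_ifs with h1 h2
    · exact absurd h2 (hn h1)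
    all_goals nlinarith [sq_nonneg (3 * ‖φ x‖ - 4 * ‖χ x‖), sq_nonneg (4 * ‖φ x‖ - 3 * ‖χ x‖),
      sq_nonneg (‖φ x‖ - ‖χ x‖)]
  have := Finset.sum_le_sum fun x (_ : x ∈ Finset.univ) => key x
  rw [← reInner_eq_sum] at this
  simp only [Finset.sum_sub_distrib, Finset.sum_add_distrib, ← Finset.mul_sum] at this
  rw [← reInner_self, ← reInner_self, hφ, hχ] at this
  linarith

/-! ### The adversary bound -/

namespace QueryAlgorithm

variable {ι : Type} [Fintype ι] [DecidableEq ι] {b : ℕ} {H : Type}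

theorem reInner_state_self (A : QueryAlgorithm ι b H) (s : ι → Fin b → Bool) (t : ℕ) :
    reInner (A.state s t) (A.state s t) = 1 := by
  induction t with
  | zero => rw [state, reInner_mulVec, reInner_self, A.init_norm]
  | succ t ih => rw [state, reInner_mulVec, reInner_oracle_self, ih]

/-- The positive-weight adversary bound: a lower bound on the number of queries of an algorithm
that succeeds on a family of inputs. -/
theorem sum_le_of_quadraticForm_le (A : QueryAlgorithm ι b H) {X : Type} [Fintype X]
    (inp : X → ι → Fin b → Bool) (Y : X → Set H)
    (hA : ∀ x, 2 / 3 ≤ A.prob (inp x) (Y x)) (Γ : X → X → ℝ) (hΓ : ∀ x y, 0 ≤ Γ x y)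
    (hdisj : ∀ x y, Γ x y ≠ 0 → Disjoint (Y x) (Y y)) (C : ℝ)
    (hC : ∀ i, ∀ w : X → ℝ, (∀ x, 0 ≤ w x) →
      ∑ x, ∑ y, (if inp x i = inp y i then 0 else Γ x y) * (w x * w y) ≤ C * ∑ x, w x ^ 2) :
    ∑ x, ∑ y, Γ x y ≤ 36 * C * Fintype.card X * A.queries := by
  -- The progress measure: it starts at the total weight, must lose a fraction `1 / 18` of it, and
  -- loses at most `2 * C * card X` per query.
  set P : ℕ → ℝ := fun t =>
    ∑ x, ∑ y, Γ x y * reInner (A.state (inp x) t) (A.state (inp y) t) with hP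
  have h0 : P 0 = ∑ x, ∑ y, Γ x y := by
    refine Finset.sum_congr rfl fun x _ => Finset.sum_congr rfl fun y _ => ?_
    have : A.state (inp x) 0 = A.state (inp y) 0 := rfl
    rw [this, reInner_state_self, mul_one]
  have hT : P A.queries ≤ 17 / 18 * ∑ x, ∑ y, Γ x y := by
    rw [Finset.mul_sum]
    refine Finset.sum_le_sum fun x _ => ?_
    rw [Finset.mul_sum]
    refine Finset.sum_le_sum fun y _ => ?_
    rcases eq_or_ne (Γ x y) 0 with h | h
    · simp [h]
    · rw [mul_comm (17 / 18)]
      exact mul_le_mul_of_nonneg_left (reInner_le_of_disjoint A.out _ _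
        (A.reInner_state_self _ _) (A.reInner_state_self _ _) (hdisj x y h) (hA x) (hA y)) (hΓ x y)
  have hstep : ∀ t, P t - P (t + 1) ≤ 2 * C * Fintype.card X := by
    intro t
    have h1 : P t - P (t + 1) ≤ ∑ x, ∑ y, Γ x y * (2 * ∑ i, if inp x i = inp y i then 0 else
        indexNorm (A.state (inp x) t) i * indexNorm (A.state (inp y) t) i) := by
      simp only [hP, ← Finset.sum_sub_distrib]
      refine Finset.sum_le_sum fun x _ => Finset.sum_le_sum fun y _ => ?_
      rw [← mul_sub]
      refine mul_le_mul_of_nonneg_left ?_ (hΓ x y)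
      rw [state, state, reInner_mulVec]
      exact reInner_sub_reInner_oracle_le _ _ _ _
    have h2 : ∑ x, ∑ y, Γ x y * (2 * ∑ i, if inp x i = inp y i then 0 else
        indexNorm (A.state (inp x) t) i * indexNorm (A.state (inp y) t) i) =
        2 * ∑ i, ∑ x, ∑ y, (if inp x i = inp y i then 0 else Γ x y) *
          (indexNorm (A.state (inp x) t) i * indexNorm (A.state (inp y) t) i) := by
      simp only [Finset.mul_sum]
      rw [Finset.sum_comm]
      conv_rhs => rw [Finset.sum_comm]; enter [2, x]; rw [Finset.sum_comm]
      rw [Finset.sum_comm]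
      refine Finset.sum_congr rfl fun x _ => Finset.sum_congr rfl fun y _ =>
        Finset.sum_congr rfl fun i _ => ?_
      split_ifs <;> ring
    -- For each index `i` the hypothesis on `C` is applied to the query magnitudes at `i`; over all
    -- `i` their squares add up to `1` for every input.
    have h3 : ∑ i, ∑ x, ∑ y, (if inp x i = inp y i then 0 else Γ x y) *
          (indexNorm (A.state (inp x) t) i * indexNorm (A.state (inp y) t) i) ≤
        ∑ i, C * ∑ x, indexNorm (A.state (inp x) t) i ^ 2 :=
      Finset.sum_le_sum fun i _ => hC i _ fun x => Real.sqrt_nonneg _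
    have h4 : ∑ i, C * ∑ x, indexNorm (A.state (inp x) t) i ^ 2 = C * Fintype.card X := by
      rw [← Finset.mul_sum, Finset.sum_comm]
      simp [sum_indexNorm_sq, reInner_state_self]
    linarith
  have htot : ∀ t, P 0 - P t ≤ 2 * C * Fintype.card X * t := by
    intro t
    induction t with
    | zero => simp
    | succ t ih => have := hstep t; push_cast; linarith
  have := htot A.queries
  linarith

end QueryAlgorithm

/-! ### The Schur test and the multiscale kernel of ordered search -/

/-- The Schur test for a symmetric nonnegative kernel. -/
theorem sum_mul_le_of_schur {X : Type} [Fintype X] (K : X → X → ℝ) (hK : ∀ x y, 0 ≤ K x y)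
    (hsymm : ∀ x y, K x y = K y x) (r : X → ℝ) (hr : ∀ x, 0 < r x) (C : ℝ)
    (hC : ∀ x, ∑ y, K x y * r y ≤ C * r x) (w : X → ℝ) :
    ∑ x, ∑ y, K x y * (w x * w y) ≤ C * ∑ x, w x ^ 2 := by
  have h1 : ∀ x y, K x y * (w x * w y) ≤
      (K x y * r y) * (w x ^ 2 / r x) / 2 + (K y x * r x) * (w y ^ 2 / r y) / 2 := by
    intro x y
    have hx := hr x
    have hy := hr y
    have : w x * w y ≤ r y * (w x ^ 2 / r x) / 2 + r x * (w y ^ 2 / r y) / 2 := by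
      have h : r y * (w x ^ 2 / r x) / 2 + r x * (w y ^ 2 / r y) / 2 - w x * w y =
          (r y * w x - r x * w y) ^ 2 / (2 * r x * r y) := by
        field_simp
        ring
      have : 0 ≤ (r y * w x - r x * w y) ^ 2 / (2 * r x * r y) := by positivity
      linarith
    rw [hsymm y x]
    calc _ ≤ K x y * (r y * (w x ^ 2 / r x) / 2 + r x * (w y ^ 2 / r y) / 2) :=
          mul_le_mul_of_nonneg_left this (hK x y)
      _ = _ := by ring
  have h2 : ∑ x, ∑ y, (K y x * r x) * (w y ^ 2 / r y) / 2 =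
      ∑ x, ∑ y, (K x y * r y) * (w x ^ 2 / r x) / 2 := Finset.sum_comm
  have h3 : ∑ x, ∑ y, (K x y * r y) * (w x ^ 2 / r x) / 2 ≤ ∑ x, C * w x ^ 2 / 2 := by
    refine Finset.sum_le_sum fun x _ => ?_
    rw [← Finset.sum_div, ← Finset.sum_mul]
    have hx := hr x
    have : (∑ y, K x y * r y) * (w x ^ 2 / r x) ≤ C * r x * (w x ^ 2 / r x) :=
      mul_le_mul_of_nonneg_right (hC x) (by positivity)
    have h : C * r x * (w x ^ 2 / r x) = C * w x ^ 2 := by field_simp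
    linarith
  have h4 := Finset.sum_le_sum fun x (_ : x ∈ Finset.univ) =>
    Finset.sum_le_sum fun y (_ : y ∈ Finset.univ) => h1 x y
  simp only [Finset.sum_add_distrib] at h4
  rw [h2] at h4
  rw [← Finset.sum_div, ← Finset.mul_sum] at h3
  linarith

/-- `s` and `t` lie in the same block of length `4 ^ l`. -/
abbrev SameBlock (l s t : ℕ) : Prop := s / 4 ^ l = t / 4 ^ l

/-- `q` lies between `s` and `t`, the ends included. -/
abbrev Between (q s t : ℕ) : Prop := (s ≤ q ∧ q ≤ t) ∨ (t ≤ q ∧ q ≤ s)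

theorem SameBlock.mono {l l' s t : ℕ} (h : SameBlock l s t) (hl : l ≤ l') : SameBlock l' s t := by
  obtain ⟨d, rfl⟩ := Nat.exists_eq_add_of_le hl
  unfold SameBlock at *
  rw [pow_add, ← Nat.div_div_eq_div_mul, ← Nat.div_div_eq_div_mul, h]

/-- Blocks are intervals. This is why pairs on two sides of `q` interact only through the single
block containing `q` at each scale. -/
theorem SameBlock.between {l s t q : ℕ} (h : SameBlock l s t) (hq : Between q s t) :
    SameBlock l s q ∧ SameBlock l t q := by
  unfold SameBlock at *
  rcases hq with ⟨h1, h2⟩ | ⟨h1, h2⟩ <;>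
  · have a := Nat.div_le_div_right (c := 4 ^ l) h1
    have b := Nat.div_le_div_right (c := 4 ^ l) h2
    omega

theorem card_sameBlock {L l : ℕ} (hl : l ≤ L) (q : Fin (4 ^ L)) :
    (Finset.univ.filter fun t : Fin (4 ^ L) => SameBlock l t q).card = 4 ^ l := by
  have hp : 0 < 4 ^ l := by positivity
  have h1 : (Finset.univ.filter fun t : Fin (4 ^ L) => SameBlock l t q).card =
      ((Finset.range (4 ^ L)).filter fun t => SameBlock l t q).card := by
    rw [Finset.card_filter, Finset.card_filter]
    exact Fin.sum_univ_eq_sum_range (fun t => if SameBlock l t q then 1 else 0) (4 ^ L)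
  rw [h1]
  have h2 : ((Finset.range (4 ^ L)).filter fun t => SameBlock l t q) =
      Finset.Ico ((q : ℕ) / 4 ^ l * 4 ^ l) ((q : ℕ) / 4 ^ l * 4 ^ l + 4 ^ l) := by
    ext t
    simp only [Finset.mem_filter, Finset.mem_range, Finset.mem_Ico, SameBlock]
    obtain ⟨d, rfl⟩ := Nat.exists_eq_add_of_le hl
    have hq : (q : ℕ) / 4 ^ l < 4 ^ d := Nat.div_lt_of_lt_mul (by rw [← pow_add]; exact q.2)
    have hq' : ((q : ℕ) / 4 ^ l + 1) * 4 ^ l ≤ 4 ^ (l + d) := 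
      (Nat.mul_le_mul_right _ hq).trans (by rw [pow_add, mul_comm])
    rw [Nat.div_eq_iff hp]
    rw [add_mul, one_mul] at hq'
    omega
  rw [h2, Nat.card_Ico, Nat.add_sub_cancel_left]

/-- The kernel that adds up the averages over the blocks of all the scales up to `4 ^ L`. -/
noncomputable def blockKernel (L s t : ℕ) : ℝ :=
  ∑ l ∈ Finset.range (L + 1), if SameBlock l s t then (1 / 4 : ℝ) ^ l else 0

/-- The part of the kernel that comes from the blocks that contain `q`. -/
noncomputable def blockKernelAt (L q s t : ℕ) : ℝ :=
  ∑ l ∈ Finset.range (L + 1), if SameBlock l s q ∧ SameBlock l t q then (1 / 4 : ℝ) ^ l else 0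

/-- The weights for the Schur test of the part of the kernel at `q`. -/
noncomputable def blockWeight (L q t : ℕ) : ℝ :=
  ∑ l ∈ Finset.range (L + 1), if SameBlock l t q then (1 / 2 : ℝ) ^ l else 0

theorem blockKernel_nonneg (L s t : ℕ) : 0 ≤ blockKernel L s t :=
  Finset.sum_nonneg fun l _ => by split_ifs <;> positivity

theorem blockKernelAt_nonneg (L q s t : ℕ) : 0 ≤ blockKernelAt L q s t :=
  Finset.sum_nonneg fun l _ => by split_ifs <;> positivity

theorem blockKernel_comm (L s t : ℕ) : blockKernel L s t = blockKernel L t s := by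
  simp only [blockKernel, SameBlock, eq_comm]

theorem blockKernel_le_at {L q s t : ℕ} (hq : Between q s t) :
    blockKernel L s t ≤ blockKernelAt L q s t := by
  refine Finset.sum_le_sum fun l _ => ?_
  by_cases h : SameBlock l s t
  · rw [if_pos h, if_pos (h.between hq)]
  · rw [if_neg h]; split_ifs <;> positivity

theorem blockWeight_pos {L : ℕ} (q t : Fin (4 ^ L)) : 0 < blockWeight L q t := by
  refine Finset.sum_pos' (fun l _ => by split_ifs <;> positivity)
    ⟨L, Finset.self_mem_range_succ L, ?_⟩
  rw [if_pos (by unfold SameBlock; rw [Nat.div_eq_of_lt t.2, Nat.div_eq_of_lt q.2])]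
  positivity

/-- Each of the `L + 1` scales contributes `4 ^ l` points of weight `4 ^ (-l)`. -/
theorem sum_blockKernel {L : ℕ} (s : Fin (4 ^ L)) :
    ∑ t : Fin (4 ^ L), blockKernel L s t = L + 1 := by
  unfold blockKernel
  rw [Finset.sum_comm]
  have : ∀ l ∈ Finset.range (L + 1), (∑ t : Fin (4 ^ L),
      if SameBlock l s t then (1 / 4 : ℝ) ^ l else 0) = 1 := by
    intro l hl
    have := card_sameBlock (Nat.lt_succ_iff.1 (Finset.mem_range.1 hl)) s
    have h : ∀ t : Fin (4 ^ L), SameBlock l s t ↔ SameBlock l t s := fun t => eq_comm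
    simp only [h]
    rw [← Finset.sum_filter, Finset.sum_const, this, nsmul_eq_mul]
    push_cast
    rw [← mul_pow]
    norm_num
  rw [Finset.sum_congr rfl this]
  simp

/-- Blocks around `q` are nested, so scales `l` and `l'` share `4 ^ min l l'` points. The scales up
to `l` give less than `2 * 2 ^ l`, the larger ones a geometric tail below `2 ^ l`. -/
theorem sum_blockWeight_le {L l : ℕ} (hl : l ≤ L) (q : Fin (4 ^ L)) :
    ∑ t : Fin (4 ^ L), (if SameBlock l t q then blockWeight L q t else 0) ≤ 3 * 2 ^ l := by
  have h1 : ∑ t : Fin (4 ^ L), (if SameBlock l t q then blockWeight L q t else 0) =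
      ∑ l' ∈ Finset.range (L + 1), (1 / 2 : ℝ) ^ l' * 4 ^ min l l' := by
    have : ∀ t : Fin (4 ^ L), (if SameBlock l t q then blockWeight L q t else 0) =
        ∑ l' ∈ Finset.range (L + 1), if SameBlock (min l l') t q then (1 / 2 : ℝ) ^ l' else 0 := by
      intro t
      split_ifs with h
      · refine Finset.sum_congr rfl fun l' _ => ?_
        congr 1
        rcases le_total l l' with hh | hh
        · rw [min_eq_left hh]; exact propext ⟨fun _ => h, fun h => h.mono hh⟩
        · rw [min_eq_right hh]
      · refine (Finset.sum_eq_zero fun l' _ => if_neg fun h' => h (h'.mono (min_le_left _ _))).symm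
    rw [Finset.sum_congr rfl fun t _ => this t, Finset.sum_comm]
    refine Finset.sum_congr rfl fun l' _ => ?_
    rw [← Finset.sum_filter, Finset.sum_const, card_sameBlock ((min_le_left l l').trans hl),
      nsmul_eq_mul, mul_comm]
    push_cast; rfl
  have h2 : ∀ N, ∑ l' ∈ Finset.range N, (1 / 2 : ℝ) ^ l' * 4 ^ min l l' ≤
      if N ≤ l + 1 then 2 ^ N else 3 * 2 ^ l - 4 ^ l * (1 / 2) ^ (N - 1) := by
    intro N
    induction N with
    | zero => simp
    | succ N ih =>
      rw [Finset.sum_range_succ]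
      rcases lt_trichotomy N (l + 1) with h | h | h
      · rw [if_pos h.le] at ih
        rw [if_pos (by omega), min_eq_right (by omega), ← mul_pow, pow_succ]
        norm_num
        linarith
      · rw [if_pos h.le] at ih
        rw [if_neg (by omega), min_eq_left (by omega)]
        subst h
        have e : (1 / 2 : ℝ) ^ (l + 1) * 4 ^ l = 2 ^ l / 2 := by
          rw [pow_succ, mul_right_comm, ← mul_pow]; norm_num; ring
        have e2 : (2 : ℝ) ^ (l + 1) = 2 * 2 ^ l := by ring
        rw [Nat.add_sub_cancel, mul_comm ((4 : ℝ) ^ l), e]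
        linarith
      · rw [if_neg (by omega)] at ih
        rw [if_neg (by omega), min_eq_left (by omega)]
        obtain ⟨M, rfl⟩ := Nat.exists_eq_add_of_lt h
        have e : (1 / 2 : ℝ) ^ (l + 1 + M) = 2 * (1 / 2) ^ (l + 1 + M + 1) := by ring
        simp only [Nat.add_sub_cancel] at *
        rw [e] at ih
        linarith
  rw [h1]
  refine (h2 _).trans ?_
  split_ifs with h
  · have : L = l := by omega
    subst this
    rw [pow_succ]
    nlinarith [pow_pos (two_pos (α := ℝ)) L]
  · have : (0 : ℝ) ≤ 4 ^ l * (1 / 2) ^ (L + 1 - 1) := by positivity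
    linarith

/-- The Schur bound no longer grows with `L`, as in Hilbert's inequality: the weight is the inverse
square root of the block size, and scale by scale `4 ^ (-l) * (3 * 2 ^ l) = 3 * 2 ^ (-l)` reproduces
it. -/
theorem sum_blockKernelAt_mul_le {L : ℕ} (q s : Fin (4 ^ L)) :
    ∑ t : Fin (4 ^ L), blockKernelAt L q s t * blockWeight L q t ≤ 3 * blockWeight L q s := by
  have h1 : ∑ t : Fin (4 ^ L), blockKernelAt L q s t * blockWeight L q t =
      ∑ l ∈ Finset.range (L + 1), (if SameBlock l s q then (1 / 4 : ℝ) ^ l else 0) *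
        ∑ t : Fin (4 ^ L), (if SameBlock l t q then blockWeight L q t else 0) := by
    unfold blockKernelAt
    simp only [Finset.sum_mul, Finset.mul_sum]
    rw [Finset.sum_comm]
    refine Finset.sum_congr rfl fun l _ => Finset.sum_congr rfl fun t _ => ?_
    rw [ite_mul, zero_mul, mul_ite, mul_zero, ite_mul, zero_mul, ite_and]
    split_ifs <;> rfl
  rw [h1]
  conv_rhs => unfold blockWeight
  rw [Finset.mul_sum]
  refine Finset.sum_le_sum fun l hl => ?_
  have := sum_blockWeight_le (Nat.lt_succ_iff.1 (Finset.mem_range.1 hl)) q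
  split_ifs with h
  · calc _ ≤ (1 / 4 : ℝ) ^ l * (3 * 2 ^ l) := mul_le_mul_of_nonneg_left this (by positivity)
      _ = 3 * (1 / 2) ^ l := by
        rw [mul_left_comm, ← mul_pow]; norm_num
  · simp

theorem sum_blockKernel_ne_ge {L : ℕ} (s : Fin (4 ^ L)) :
    3 / 4 * (L : ℝ) ≤ ∑ t : Fin (4 ^ L), if s = t then 0 else blockKernel L s t := by
  have h1 : ∑ t : Fin (4 ^ L), (if s = t then 0 else blockKernel L s t) =
      L + 1 - blockKernel L s s := by
    rw [← sum_blockKernel s, eq_sub_iff_add_eq]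
    conv_rhs => rw [← Finset.add_sum_erase _ _ (Finset.mem_univ s)]
    rw [← Finset.add_sum_erase _ _ (Finset.mem_univ s), if_pos rfl, zero_add, add_comm]
    congr 1
    exact Finset.sum_congr rfl fun t ht => if_neg (Finset.ne_of_mem_erase ht).symm
  have h2 : blockKernel L s s = 4 / 3 * (1 - (1 / 4 : ℝ) ^ (L + 1)) := by
    unfold blockKernel
    simp only [SameBlock, if_true]
    rw [geom_sum_eq (by norm_num)]
    ring
  -- Bounding the diagonal by `4 / 3` would be too weak for `L = 0` and `L = 1`.
  have h3 : ∀ N : ℕ, 4 / 3 * (1 - (1 / 4 : ℝ) ^ (N + 1)) ≤ 1 + N / 4 := by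
    intro N
    induction N with
    | zero => norm_num
    | succ N ih =>
      have : (1 / 4 : ℝ) ^ (N + 1) ≤ 1 / 4 := by
        rw [pow_succ]
        have : (1 / 4 : ℝ) ^ N ≤ 1 := pow_le_one₀ (by norm_num) (by norm_num)
        linarith
      rw [pow_succ _ (N + 1)]
      push_cast
      linarith
  have := h3 L
  rw [h1, h2]
  linarith

/-! ### Herringbone maps of staircases -/

namespace Herringbone

/-- The first coordinate of the image of `(x, y)` under the herringbone map of the staircase that
occupies the heights `g x, …, g (x + 1)` of the column `x`, with the fixed point `(p, q)`. -/
def moveX (g : ℕ → ℕ) (p x y : ℕ) : ℕ :=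
  if y < g x ∨ (y = g x ∧ p < x) then x - 1
  else if g (x + 1) < y ∨ (y = g (x + 1) ∧ x < p) then x + 1
  else x

/-- The second coordinate of the image of `(x, y)` under the herringbone map. -/
def moveY (g : ℕ → ℕ) (q x y : ℕ) : ℕ :=
  if (y < q ∧ y < g (x + 1)) ∨ y < g x then y + 1
  else if (q < y ∧ g x < y) ∨ g (x + 1) < y then y - 1
  else y

variable {g : ℕ → ℕ}

/-- For distinct columns the order can break only if they are adjacent and move towards each other.
Then both heights equal `g (x + 1)`, and the moves along this common segment would require `x < p <
x + 1`. -/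
theorem moveX_mono (hg : Monotone g) (p : ℕ) {x y x' y' : ℕ} (hx : x ≤ x') (hy : y ≤ y') :
    moveX g p x y ≤ moveX g p x' y' := by
  have h1 := hg hx
  have h2 := hg (Nat.succ_le_succ hx)
  have h3 := hg (Nat.le_succ x)
  have h4 := hg (Nat.le_succ x')
  have h5 : x < x' → g (x + 1) ≤ g x' := fun h => hg h
  simp only [Nat.succ_eq_add_one] at *
  unfold moveX
  rcases hx.lt_or_eq with h | rfl
  · have := h5 h
    have h6 : x' = x + 1 → g x' = g (x + 1) := fun h => by rw [h]
    by_cases h7 : x' = x + 1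
    · have := h6 h7
      split_ifs <;> omega
    · split_ifs <;> omega
  · split_ifs <;> omega

theorem moveY_mono (hg : Monotone g) (q : ℕ) {x y x' y' : ℕ} (hx : x ≤ x') (hy : y ≤ y') :
    moveY g q x y ≤ moveY g q x' y' := by
  have h1 := hg hx
  have h2 := hg (Nat.succ_le_succ hx)
  have h3 := hg (Nat.le_succ x)
  have h4 := hg (Nat.le_succ x')
  have h5 : x < x' → g (x + 1) ≤ g x' := fun h => hg h
  simp only [Nat.succ_eq_add_one] at *
  unfold moveY
  rcases hx.lt_or_eq with h | rfl
  · have := h5 h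
    split_ifs <;> omega
  · split_ifs <;> omega

/-- The only fixed point of the herringbone map, cut off at `n - 1`, is `(p, q)`. -/
theorem eq_of_move_eq (hg : Monotone g) {n p q x y : ℕ} (hp : p < n) (hq : q < n) (hx : x < n)
    (h1 : g p ≤ q) (h2 : q ≤ g (p + 1)) (hX : min (moveX g p x y) (n - 1) = x)
    (hY : min (moveY g q x y) (n - 1) = y) : x = p := by
  have h3 := hg (Nat.le_succ x)
  have h4 : x < p → g (x + 1) ≤ g p := fun h => hg h
  have h5 : p < x → g (p + 1) ≤ g x := fun h => hg h
  have h6 := hg (Nat.zero_le p)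
  have h7 : x = 0 → g x = g 0 := fun h => by rw [h]
  have h8 := hg (Nat.zero_le x)
  simp only [Nat.succ_eq_add_one] at *
  unfold moveX at hX
  unfold moveY at hY
  rcases lt_trichotomy x p with h | h | h
  · have := h4 h
    split_ifs at hX hY <;> omega
  · exact h
  · have := h5 h
    split_ifs at hX hY <;> omega

/-- The corner coordinates of a staircase: `line m c a` lies in the `a`-th strip of width `m`. -/
def line (m : ℕ) (c : ℕ → ℕ) (a : ℕ) : ℕ := a * m + c a

/-- The lowest height at the column `x` of the staircase with vertical segments at the columns
`line m u a` and horizontal segments at the heights `line m v a`. -/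
def stair (m : ℕ) (u v : ℕ → ℕ) (x : ℕ) : ℕ :=
  if x ≤ line m u (x / m) then line m v (x / m) else line m v (x / m + 1)

theorem line_div {m : ℕ} {c : ℕ → ℕ} {a : ℕ} (h : c a < m) : line m c a / m = a := by
  unfold line
  rw [mul_comm, Nat.mul_add_div (by omega), Nat.div_eq_of_lt h, add_zero]

theorem line_strictMono {m : ℕ} {c : ℕ → ℕ} (h : ∀ a, c a < m) : StrictMono (line m c) := by
  refine strictMono_nat_of_lt_succ fun a => ?_
  have := h a
  unfold line
  rw [add_mul]
  omega

theorem stair_mono {m : ℕ} {u v : ℕ → ℕ} (hv : ∀ a, v a < m) : Monotone (stair m u v) := by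
  intro x x' h
  have hm := (line_strictMono hv).monotone
  have hd : x / m ≤ x' / m := Nat.div_le_div_right h
  unfold stair
  rcases hd.lt_or_eq with hlt | heq
  · have h1 : line m v (x / m) ≤ line m v (x / m + 1) := hm (by omega)
    have h2 : line m v (x / m + 1) ≤ line m v (x' / m) := hm (by omega)
    have h3 : line m v (x' / m) ≤ line m v (x' / m + 1) := hm (by omega)
    split_ifs <;> omega
  · rw [← heq]
    have h1 : line m v (x / m) ≤ line m v (x / m + 1) := hm (by omega)
    split_ifs <;> omega

theorem stair_succ {m : ℕ} {u v : ℕ → ℕ} (hu : ∀ a, u a < m) (x : ℕ) :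
    stair m u v (x + 1) =
      if x < line m u (x / m) then line m v (x / m) else line m v (x / m + 1) := by
  have hm : 0 < m := (Nat.zero_le _).trans_lt (hu 0)
  have hx := Nat.div_add_mod x m
  have hx' := Nat.mod_lt x hm
  by_cases h : x % m + 1 < m
  · have : (x + 1) / m = x / m := by
      conv_lhs => rw [← hx, add_assoc, Nat.mul_add_div hm, Nat.div_eq_of_lt h, add_zero]
    unfold stair
    rw [this]
    simp only [Nat.succ_le_iff]
  · have h1 : x % m + 1 = m := by omega
    have h2 : x + 1 = (x / m + 1) * m := by rw [add_mul, mul_comm (x / m)]; omega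
    have h3 : (x + 1) / m = x / m + 1 := by rw [h2, Nat.mul_div_cancel _ hm]
    unfold stair
    rw [h3, if_pos (by unfold line; omega), if_neg]
    have := hu (x / m)
    unfold line
    rw [add_mul] at h2
    omega

theorem stair_line {m : ℕ} {u v : ℕ → ℕ} (hu : ∀ a, u a < m) (a : ℕ) :
    stair m u v (line m u a) = line m v a := by
  unfold stair
  rw [line_div (hu a), if_pos le_rfl]

/-- The strip numbers decide every comparison except that with the line in the point's own strip, so
each coordinate of a query probes one offset only. -/
theorem lt_line_iff {m : ℕ} {c : ℕ → ℕ} (h : ∀ a, c a < m) (x a : ℕ) :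
    x < line m c a ↔ x / m < a ∨ (x / m = a ∧ x < line m c (x / m)) := by
  have hm : 0 < m := (Nat.zero_le _).trans_lt (h 0)
  constructor
  · intro hlt
    have : x / m ≤ a := line_div (h a) ▸ Nat.div_le_div_right hlt.le
    rcases this.lt_or_eq with h1 | h1
    · exact Or.inl h1
    · exact Or.inr ⟨h1, by rwa [h1]⟩
  · rintro (h1 | ⟨h1, h2⟩)
    · exact lt_of_not_ge fun h2 => absurd (Nat.div_le_div_right (c := m) h2) (by
        rw [line_div (h a)]; omega)
    · rwa [h1] at h2

theorem line_lt_iff {m : ℕ} {c : ℕ → ℕ} (h : ∀ a, c a < m) (x a : ℕ) :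
    line m c a < x ↔ a < x / m ∨ (x / m = a ∧ line m c (x / m) < x) := by
  have hm : 0 < m := (Nat.zero_le _).trans_lt (h 0)
  constructor
  · intro hlt
    have : a ≤ x / m := line_div (h a) ▸ Nat.div_le_div_right hlt.le
    rcases this.lt_or_eq with h1 | h1
    · exact Or.inl h1
    · exact Or.inr ⟨h1.symm, by rwa [← h1]⟩
  · rintro (h1 | ⟨h1, h2⟩)
    · exact lt_of_not_ge fun h2 => absurd (Nat.div_le_div_right (c := m) h2) (by
        rw [line_div (h a)]; omega)
    · rwa [h1] at h2

/-- The images of `(x, y)` under the herringbone maps of two staircases agree if `x` and `y` are in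
the same position relative to the segments of both, and are not on a segment that the staircases
have in common between their fixed points. -/
theorem move_eq_of_compare {m : ℕ} {u v u' v' : ℕ → ℕ} (hu : ∀ a, u a < m) (hv : ∀ a, v a < m)
    (hu' : ∀ a, u' a < m) (hv' : ∀ a, v' a < m) {j j' : ℕ} (hj : j ≤ j') (x y : ℕ)
    (h1 : x < line m u (x / m) ↔ x < line m u' (x / m))
    (h2 : line m u (x / m) < x ↔ line m u' (x / m) < x)
    (h3 : y < line m v (y / m) ↔ y < line m v' (y / m))
    (h4 : line m v (y / m) < y ↔ line m v' (y / m) < y)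
    (h5 : j ≤ x / m → x / m ≤ j' → x ≠ line m u (x / m))
    (h6 : j ≤ y / m → y / m ≤ j' → y ≠ line m v (y / m)) :
    moveX (stair m u v) (line m u j) x y = moveX (stair m u' v') (line m u' j') x y ∧
    moveY (stair m u v) (line m v j) x y = moveY (stair m u' v') (line m v' j') x y := by
  have hlt : ∀ a, y < line m v a ↔ y < line m v' a := fun a => by
    rw [lt_line_iff hv, lt_line_iff hv', h3]
  have hgt : ∀ a, line m v a < y ↔ line m v' a < y := fun a => by
    rw [line_lt_iff hv, line_lt_iff hv', h4]
  have heq : ∀ a, y = line m v a ↔ y = line m v' a := fun a => by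
    have := hlt a; have := hgt a; omega
  have hB : ∀ a, y = line m v a → y / m = a := fun a h => h ▸ line_div (hv a)
  have hs0 : stair m u v x = if x ≤ line m u (x / m) then _ else _ := rfl
  have hs0' : stair m u' v' x = if x ≤ line m u' (x / m) then _ else _ := rfl
  have hs1 := stair_succ (v := v) hu x
  have hs1' := stair_succ (v := v') hu' x
  -- The column `x` meets both staircases from horizontal line `b` to horizontal line `c`, with the
  -- same indices; `b` and `c` differ only on a vertical segment.
  obtain ⟨b, c, e0, e0', e1, e1', hbc⟩ : ∃ b c, stair m u v x = line m v b ∧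
      stair m u' v' x = line m v' b ∧ stair m u v (x + 1) = line m v c ∧
      stair m u' v' (x + 1) = line m v' c ∧
      ((b = x / m ∧ c = x / m ∧ x < line m u (x / m)) ∨
        (b = x / m ∧ c = x / m + 1 ∧ x = line m u (x / m)) ∨
        (b = x / m + 1 ∧ c = x / m + 1 ∧ line m u (x / m) < x)) := by
    rcases lt_trichotomy x (line m u (x / m)) with h | h | h
    · refine ⟨x / m, x / m, ?_, ?_, ?_, ?_, Or.inl ⟨rfl, rfl, h⟩⟩
      · rw [hs0, if_pos h.le]
      · rw [hs0', if_pos (h1.1 h).le]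
      · rw [hs1, if_pos h]
      · rw [hs1', if_pos (h1.1 h)]
    · refine ⟨x / m, x / m + 1, ?_, ?_, ?_, ?_, Or.inr (Or.inl ⟨rfl, rfl, h⟩)⟩
      · rw [hs0, if_pos h.le]
      · rw [hs0', if_pos (by omega)]
      · rw [hs1, if_neg (by omega)]
      · rw [hs1', if_neg (by omega)]
    · refine ⟨x / m + 1, x / m + 1, ?_, ?_, ?_, ?_, Or.inr (Or.inr ⟨rfl, rfl, h⟩)⟩
      · rw [hs0, if_neg (by omega)]
      · rw [hs0', if_neg (by omega)]
      · rw [hs1, if_neg (by omega)]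
      · rw [hs1', if_neg (by omega)]
  have h5' : x / m < j ∨ j' < x / m ∨ x ≠ line m u (x / m) := by
    by_contra hn
    exact h5 (by omega) (by omega) (by omega)
  -- On a horizontal segment the side of the fixed point matters, but the segment's index `b` lies
  -- outside `[j, j']`, so both fixed points are on the same side.
  have k1 : (y = line m v b ∧ line m u j < x) ↔ (y = line m v b ∧ line m u' j' < x) := by
    refine and_congr_right fun hy => ?_
    have hyb := hB b hy
    rw [line_lt_iff hu, line_lt_iff hu', ← h2]
    have h6' : y / m < j ∨ j' < y / m := by
      by_contra hn
      exact h6 (by omega) (by omega) (by rwa [hyb])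
    clear * - hbc h5' h6' hj hyb
    generalize line m u (x / m) = z at *
    generalize x / m = A at *
    generalize y / m = B at *
    rcases hbc with h | h | h <;> omega
  have k2 : (y = line m v c ∧ x < line m u j) ↔ (y = line m v c ∧ x < line m u' j') := by
    refine and_congr_right fun hy => ?_
    have hyb := hB c hy
    rw [lt_line_iff hu, lt_line_iff hu', ← h1]
    have h6' : y / m < j ∨ j' < y / m := by
      by_contra hn
      exact h6 (by omega) (by omega) (by rwa [hyb])
    clear * - hbc h5' h6' hj hyb
    generalize line m u (x / m) = z at *
    generalize x / m = A at *
    generalize y / m = B at *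
    rcases hbc with h | h | h <;> omega
  -- If `b = c`, the clause with the fixed point is absorbed; otherwise `x` is on a vertical
  -- segment, whose strip lies outside `[j, j']`.
  have k3 : ((y < line m v j ∧ y < line m v c) ∨ y < line m v b) ↔
      ((y < line m v' j' ∧ y < line m v c) ∨ y < line m v b) := by
    rcases hbc with ⟨rfl, rfl, -⟩ | ⟨rfl, rfl, h⟩ | ⟨rfl, rfl, -⟩
    · rw [or_iff_right_of_imp And.right, or_iff_right_of_imp And.right]
    · have h5'' : x / m < j ∨ j' < x / m := by omega
      rw [lt_line_iff hv y j, lt_line_iff hv' y j', ← h3, lt_line_iff hv y (x / m), lt_line_iff hv y (x / m + 1)]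
      clear * - h5'' hj h6
      generalize line m v (y / m) = z' at *
      generalize x / m = A at *
      generalize y / m = B at *
      by_cases hA : B = A <;> omega
    · rw [or_iff_right_of_imp And.right, or_iff_right_of_imp And.right]
  have k4 : ((line m v j < y ∧ line m v b < y) ∨ line m v c < y) ↔
      ((line m v' j' < y ∧ line m v b < y) ∨ line m v c < y) := by
    rcases hbc with ⟨rfl, rfl, -⟩ | ⟨rfl, rfl, h⟩ | ⟨rfl, rfl, -⟩
    · rw [or_iff_right_of_imp And.right, or_iff_right_of_imp And.right]
    · have h5'' : x / m < j ∨ j' < x / m := by omega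
      rw [line_lt_iff hv y j, line_lt_iff hv' y j', ← h4, line_lt_iff hv y (x / m), line_lt_iff hv y (x / m + 1)]
      clear * - h5'' hj h6
      generalize line m v (y / m) = z' at *
      generalize x / m = A at *
      generalize y / m = B at *
      by_cases hA : B = A <;> omega
    · rw [or_iff_right_of_imp And.right, or_iff_right_of_imp And.right]
  unfold moveX moveY
  simp only [e0, e0', e1, e1', ← hlt, ← hgt, ← heq, k1, k2, k3, k4, and_self]

end Herringbone

/-! ### The adversary matrix and its Schur bounds -/

/-- The hidden data of a herringbone map with `4 ^ L` strips: the strip of the fixed point, and the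
offsets of the vertical segment (`true`) and of the horizontal segment (`false`) of each strip. -/
abbrev HiddenStair (L : ℕ) : Type := Fin (4 ^ L) × (Fin (4 ^ L) × Bool → Fin (4 ^ L))

namespace HiddenStair

variable {L : ℕ}

/-- The transition weight of the offset of a segment in the strip `a`, when the strip of the fixed
point moves from `i` to `j`: only the offsets between `i` and `j` are resampled. -/
noncomputable def offsetKernel (L i j a : ℕ) (s t : Fin (4 ^ L)) : ℝ :=
  if Between a i j then blockKernel L s t / (L + 1) else if s = t then 1 else 0

/-- The adversary matrix. -/
noncomputable def kernel (x y : HiddenStair L) : ℝ :=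
  (if x.1 = y.1 then 0 else blockKernel L x.1 y.1) *
    ∏ v, offsetKernel L x.1 y.1 v.1 (x.2 v) (y.2 v)

theorem offsetKernel_nonneg (i j a : ℕ) (s t : Fin (4 ^ L)) : 0 ≤ offsetKernel L i j a s t := by
  unfold offsetKernel
  have := blockKernel_nonneg L s t
  split_ifs <;> positivity

theorem between_comm {a i j : ℕ} : Between a i j ↔ Between a j i := by
  unfold Between; exact or_comm

theorem offsetKernel_comm (i j a : ℕ) (s t : Fin (4 ^ L)) :
    offsetKernel L i j a s t = offsetKernel L j i a t s := by
  unfold offsetKernel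
  rw [blockKernel_comm]
  simp only [between_comm (i := i), eq_comm (a := s)]

theorem sum_offsetKernel (i j a : ℕ) (s : Fin (4 ^ L)) : ∑ t, offsetKernel L i j a s t = 1 := by
  unfold offsetKernel
  split_ifs with h
  · rw [← Finset.sum_div, sum_blockKernel, div_self (by positivity)]
  · simp

theorem kernel_nonneg (x y : HiddenStair L) : 0 ≤ kernel x y := by
  refine mul_nonneg ?_ (Finset.prod_nonneg fun v _ => offsetKernel_nonneg _ _ _ _ _)
  have := blockKernel_nonneg L x.1 y.1
  split_ifs <;> positivity

theorem kernel_comm (x y : HiddenStair L) : kernel x y = kernel y x := by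
  unfold kernel
  rw [blockKernel_comm]
  simp only [eq_comm (a := x.1)]
  congr 1
  exact Finset.prod_congr rfl fun v _ => offsetKernel_comm _ _ _ _ _

theorem fst_ne_of_kernel_ne_zero {x y : HiddenStair L} (h : kernel x y ≠ 0) : x.1 ≠ y.1 :=
  fun he => h (by simp [kernel, he])

theorem snd_eq_of_kernel_ne_zero {x y : HiddenStair L} (h : kernel x y ≠ 0)
    (v : Fin (4 ^ L) × Bool) (hv : ¬Between v.1 x.1 y.1) : x.2 v = y.2 v := by
  by_contra hne
  refine h (mul_eq_zero_of_right _ (Finset.prod_eq_zero (Finset.mem_univ v) ?_))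
  rw [offsetKernel, if_neg hv, if_neg hne]

theorem sum_prod_eq {κ τ : Type} [Fintype κ] [DecidableEq κ] [Fintype τ] (f : κ → τ → ℝ) :
    ∑ h : κ → τ, ∏ v, f v (h v) = ∏ v, ∑ t, f v t := by
  rw [Finset.prod_univ_sum, Fintype.piFinset_univ]

/-- The offset factors are transition probabilities and sum to `1`, which leaves the off-diagonal
row sums of the strip kernel. -/
theorem sum_kernel_ge (L : ℕ) : 3 / 4 * (L : ℝ) * Fintype.card (HiddenStair L) ≤
    ∑ x : HiddenStair L, ∑ y : HiddenStair L, kernel x y := by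
  have h : ∀ x : HiddenStair L, 3 / 4 * (L : ℝ) ≤ ∑ y : HiddenStair L, kernel x y := by
    intro x
    refine (sum_blockKernel_ne_ge x.1).trans (le_of_eq ?_)
    rw [Fintype.sum_prod_type]
    refine Finset.sum_congr rfl fun j _ => ?_
    unfold kernel
    simp only
    rw [← Finset.mul_sum, sum_prod_eq fun v t => offsetKernel L x.1 j v.1 (x.2 v) t]
    simp [sum_offsetKernel]
  calc _ = ∑ _x : HiddenStair L, 3 / 4 * (L : ℝ) := by
        rw [Finset.sum_const, nsmul_eq_mul, Finset.card_univ, mul_comm]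
    _ ≤ _ := Finset.sum_le_sum fun x _ => h x

/-- The part of the adversary matrix on the pairs for which the offset of `v` is resampled, with
`q` between the old offset and the new one. -/
noncomputable def kernelAt (v : Fin (4 ^ L) × Bool) (q : Fin (4 ^ L)) (x y : HiddenStair L) : ℝ :=
  if Between v.1 x.1 y.1 ∧ Between q (x.2 v) (y.2 v) then kernel x y else 0

theorem kernelAt_nonneg (v : Fin (4 ^ L) × Bool) (q : Fin (4 ^ L)) (x y : HiddenStair L) :
    0 ≤ kernelAt v q x y := by
  unfold kernelAt
  split_ifs
  exacts [kernel_nonneg x y, le_rfl]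

theorem kernelAt_comm (v : Fin (4 ^ L) × Bool) (q : Fin (4 ^ L)) (x y : HiddenStair L) :
    kernelAt v q x y = kernelAt v q y x := by
  unfold kernelAt
  rw [kernel_comm]
  simp only [between_comm (i := (x.1 : ℕ)), between_comm (i := (x.2 v : ℕ))]

/-- In the majorant the factor at `v` no longer depends on the strips of the fixed points, so the
sums over the strip and over that offset separate. -/
theorem kernelAt_le (v : Fin (4 ^ L) × Bool) (q : Fin (4 ^ L)) (x y : HiddenStair L) :
    kernelAt v q x y ≤ blockKernelAt L v.1 x.1 y.1 *
      ∏ v', if v' = v then blockKernelAt L q (x.2 v') (y.2 v') / (L + 1)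
        else offsetKernel L x.1 y.1 v'.1 (x.2 v') (y.2 v') := by
  have hpos : ∀ v', 0 ≤ if v' = v then blockKernelAt L q (x.2 v') (y.2 v') / ((L : ℝ) + 1)
        else offsetKernel L x.1 y.1 v'.1 (x.2 v') (y.2 v') := by
    intro v'
    have := blockKernelAt_nonneg L q (x.2 v') (y.2 v')
    split_ifs
    · positivity
    · exact offsetKernel_nonneg _ _ _ _ _
  unfold kernelAt
  split_ifs with h
  · refine mul_le_mul ?_ ?_ (Finset.prod_nonneg fun v' _ => offsetKernel_nonneg _ _ _ _ _)
      (blockKernelAt_nonneg _ _ _ _)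
    · split_ifs
      exacts [blockKernelAt_nonneg _ _ _ _, blockKernel_le_at h.1]
    · refine Finset.prod_le_prod (fun v' _ => offsetKernel_nonneg _ _ _ _ _) fun v' _ => ?_
      split_ifs with hv
      · subst hv
        rw [offsetKernel, if_pos h.1]
        exact div_le_div_of_nonneg_right (blockKernel_le_at h.2) (by positivity)
      · exact le_rfl
  · exact mul_nonneg (blockKernelAt_nonneg _ _ _ _) (Finset.prod_nonneg fun v' _ => hpos v')

/-- The weight is a product, so the two ordered searches give `3` each; `L + 1` is the normalisation
of the resampled offset, and the other offsets sum to `1`. -/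
theorem sum_kernelAt_mul_le (v : Fin (4 ^ L) × Bool) (q : Fin (4 ^ L)) (x : HiddenStair L) :
    ∑ y : HiddenStair L, kernelAt v q x y * (blockWeight L v.1 y.1 * blockWeight L q (y.2 v)) ≤
      9 / (L + 1) * (blockWeight L v.1 x.1 * blockWeight L q (x.2 v)) := by
  have hL : (0 : ℝ) < L + 1 := by positivity
  have hw : ∀ p t : Fin (4 ^ L), 0 < blockWeight L p t := blockWeight_pos
  calc _ ≤ ∑ y : HiddenStair L, (blockKernelAt L v.1 x.1 y.1 *
      ∏ v', if v' = v then blockKernelAt L q (x.2 v') (y.2 v') / ((L : ℝ) + 1)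
        else offsetKernel L x.1 y.1 v'.1 (x.2 v') (y.2 v')) *
          (blockWeight L v.1 y.1 * blockWeight L q (y.2 v)) :=
        Finset.sum_le_sum fun y _ => mul_le_mul_of_nonneg_right (kernelAt_le v q x y)
          (mul_pos (hw _ _) (hw _ _)).le
    _ = ∑ j : Fin (4 ^ L), blockKernelAt L v.1 x.1 j * blockWeight L v.1 j *
          ∑ h : Fin (4 ^ L) × Bool → Fin (4 ^ L), ∏ v', if v' = v then
            blockKernelAt L q (x.2 v') (h v') * blockWeight L q (h v') / ((L : ℝ) + 1)
            else offsetKernel L x.1 j v'.1 (x.2 v') (h v') := by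
        rw [Fintype.sum_prod_type]
        refine Finset.sum_congr rfl fun j _ => ?_
        rw [Finset.mul_sum]
        refine Finset.sum_congr rfl fun h _ => ?_
        simp only
        rw [← Finset.mul_prod_erase _ _ (Finset.mem_univ v),
          ← Finset.mul_prod_erase (a := v) _ (fun v' => if v' = v then
            blockKernelAt L q (x.2 v') (h v') * blockWeight L q (h v') / ((L : ℝ) + 1)
            else offsetKernel L x.1 j v'.1 (x.2 v') (h v')) (Finset.mem_univ v)]
        have : ∀ F G G' : Fin (4 ^ L) × Bool → ℝ,
            ∏ v' ∈ Finset.univ.erase v, (if v' = v then G v' else F v') =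
            ∏ v' ∈ Finset.univ.erase v, (if v' = v then G' v' else F v') := fun F G G' =>
          Finset.prod_congr rfl fun v' hv' => by
            rw [if_neg (Finset.ne_of_mem_erase hv'), if_neg (Finset.ne_of_mem_erase hv')]
        rw [if_pos rfl, if_pos rfl, this _ _ fun v' =>
          blockKernelAt L q (x.2 v') (h v') * blockWeight L q (h v') / ((L : ℝ) + 1)]
        ring
    _ ≤ ∑ j : Fin (4 ^ L), blockKernelAt L v.1 x.1 j * blockWeight L v.1 j *
          (3 * blockWeight L q (x.2 v) / (L + 1)) := by
        refine Finset.sum_le_sum fun j _ => mul_le_mul_of_nonneg_left ?_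
          (mul_nonneg (blockKernelAt_nonneg _ _ _ _) (hw _ _).le)
        rw [sum_prod_eq fun v' (t : Fin (4 ^ L)) => if v' = v then
            blockKernelAt L q (x.2 v') t * blockWeight L q t / ((L : ℝ) + 1)
            else offsetKernel L x.1 j v'.1 (x.2 v') t,
          Finset.prod_eq_single_of_mem v (Finset.mem_univ v)]
        · simp only [if_true]
          rw [← Finset.sum_div]
          exact div_le_div_of_nonneg_right (sum_blockKernelAt_mul_le q (x.2 v)) hL.le
        · intro v' _ hv'
          simp only [if_neg hv', sum_offsetKernel]
    _ = (∑ j : Fin (4 ^ L), blockKernelAt L v.1 x.1 j * blockWeight L v.1 j) *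
          (3 * blockWeight L q (x.2 v) / (L + 1)) := by rw [Finset.sum_mul]
    _ ≤ (3 * blockWeight L v.1 x.1) * (3 * blockWeight L q (x.2 v) / (L + 1)) := by
        have := (hw q (x.2 v)).le
        exact mul_le_mul_of_nonneg_right (sum_blockKernelAt_mul_le v.1 x.1) (by positivity)
    _ = _ := by ring

theorem quadraticForm_kernelAt_le (v : Fin (4 ^ L) × Bool) (q : Fin (4 ^ L))
    (w : HiddenStair L → ℝ) :
    ∑ x, ∑ y, kernelAt v q x y * (w x * w y) ≤ 9 / (L + 1) * ∑ x, w x ^ 2 :=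
  sum_mul_le_of_schur _ (kernelAt_nonneg v q) (kernelAt_comm v q)
    (fun x => blockWeight L v.1 x.1 * blockWeight L q (x.2 v))
    (fun _ => mul_pos (blockWeight_pos _ _) (blockWeight_pos _ _)) _ (sum_kernelAt_mul_le v q) w

/-! ### What a query can detect -/

/-- The offset of a segment in the strip `a`, extended by `0` to the strips with `4 ^ L ≤ a`. -/
def offset (x : HiddenStair L) (d : Bool) (a : ℕ) : ℕ :=
  if h : a < 4 ^ L then x.2 (⟨a, h⟩, d) else 0

theorem offset_lt (x : HiddenStair L) (d : Bool) (a : ℕ) : x.offset d a < 4 ^ L := by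
  unfold offset
  split_ifs
  · exact Fin.isLt _
  · positivity

open Herringbone

/-- The heights of the staircase. -/
def heights (x : HiddenStair L) : ℕ → ℕ := stair (4 ^ L) (x.offset true) (x.offset false)

theorem heights_mono (x : HiddenStair L) : Monotone x.heights := stair_mono (x.offset_lt false)

/-- The first coordinate of the image of a point under the herringbone map. -/
def imageX (x : HiddenStair L) (p q : ℕ) : ℕ :=
  moveX x.heights (line (4 ^ L) (x.offset true) x.1) p q

/-- The second coordinate of the image of a point under the herringbone map. -/
def imageY (x : HiddenStair L) (p q : ℕ) : ℕ :=
  moveY x.heights (line (4 ^ L) (x.offset false) x.1) p q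

/-- The query of the coordinate `p` distinguishes `x` from `y` through the segments with the
direction `d`. -/
def Detects (x y : HiddenStair L) (d : Bool) (p : ℕ) : Prop :=
  ∃ h : p / 4 ^ L < 4 ^ L, Between (p / 4 ^ L) x.1 y.1 ∧
    Between (p % 4 ^ L) (x.2 (⟨p / 4 ^ L, h⟩, d)) (y.2 (⟨p / 4 ^ L, h⟩, d))

theorem detects_comm {x y : HiddenStair L} {d : Bool} {p : ℕ} :
    Detects x y d p ↔ Detects y x d p := by
  unfold Detects
  simp only [between_comm (i := (x.1 : ℕ)), between_comm (j := ((y.2 _ : Fin _) : ℕ))]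

theorem lt_line_div {m x : ℕ} (c : ℕ → ℕ) : x < line m c (x / m) ↔ x % m < c (x / m) := by
  have := Nat.div_add_mod' x m
  unfold line
  omega

theorem line_div_lt {m x : ℕ} (c : ℕ → ℕ) : line m c (x / m) < x ↔ c (x / m) < x % m := by
  have := Nat.div_add_mod' x m
  unfold line
  omega

/-- Offsets outside the resampled range coincide. Inside it, a position not between the two offsets
is strictly on one side of both, since `Between` includes the ends. -/
theorem compare_of_not_detects {x y : HiddenStair L} (hxy : kernel x y ≠ 0)
    {d : Bool} {p : ℕ} (h : ¬Detects x y d p) :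
    (p < line (4 ^ L) (x.offset d) (p / 4 ^ L) ↔ p < line (4 ^ L) (y.offset d) (p / 4 ^ L)) ∧
    (line (4 ^ L) (x.offset d) (p / 4 ^ L) < p ↔ line (4 ^ L) (y.offset d) (p / 4 ^ L) < p) ∧
    (Between (p / 4 ^ L) x.1 y.1 → p ≠ line (4 ^ L) (x.offset d) (p / 4 ^ L)) := by
  have hne : p = line (4 ^ L) (x.offset d) (p / 4 ^ L) ↔ p % 4 ^ L = x.offset d (p / 4 ^ L) := by
    have h1 := lt_line_div (m := 4 ^ L) (x := p) (x.offset d)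
    have h2 := line_div_lt (m := 4 ^ L) (x := p) (x.offset d)
    omega
  rw [lt_line_div, lt_line_div, line_div_lt, line_div_lt, Ne, hne]
  unfold offset
  by_cases hp : p / 4 ^ L < 4 ^ L
  · simp only [dif_pos hp]
    by_cases hb : Between (p / 4 ^ L) x.1 y.1
    · have : ¬Between (p % 4 ^ L) (x.2 (⟨p / 4 ^ L, hp⟩, d)) (y.2 (⟨p / 4 ^ L, hp⟩, d)) :=
        fun h' => h ⟨hp, hb, h'⟩
      unfold Between at this
      generalize (x.2 (⟨p / 4 ^ L, hp⟩, d) : ℕ) = s at *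
      generalize (y.2 (⟨p / 4 ^ L, hp⟩, d) : ℕ) = t at *
      generalize p % 4 ^ L = r at *
      clear * - this
      omega
    · rw [snd_eq_of_kernel_ne_zero hxy (⟨p / 4 ^ L, hp⟩, d) hb]
      exact ⟨Iff.rfl, Iff.rfl, fun h' => absurd h' hb⟩
  -- Past the last strip both offsets have the default value `0`, and no such strip lies between two
  -- fixed points.
  · simp only [dif_neg hp, true_and]
    intro hb
    have h1 := x.1.2
    have h2 := y.1.2
    unfold Between at hb
    omega

theorem image_eq_of_not_detects {x y : HiddenStair L} (hxy : kernel x y ≠ 0) {p q : ℕ}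
    (hp : ¬Detects x y true p) (hq : ¬Detects x y false q) :
    x.imageX p q = y.imageX p q ∧ x.imageY p q = y.imageY p q := by
  wlog hle : (x.1 : ℕ) ≤ y.1 generalizing x y
  · have := this (x := y) (y := x) (by rwa [kernel_comm]) (by rwa [detects_comm])
      (by rwa [detects_comm]) (by omega)
    exact ⟨this.1.symm, this.2.symm⟩
  obtain ⟨h1, h2, h5⟩ := compare_of_not_detects hxy hp
  obtain ⟨h3, h4, h6⟩ := compare_of_not_detects hxy hq
  exact move_eq_of_compare (x.offset_lt true) (x.offset_lt false) (y.offset_lt true)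
    (y.offset_lt false) hle p q h1 h2 h3 h4 (fun a b => h5 (Or.inl ⟨a, b⟩))
    (fun a b => h6 (Or.inl ⟨a, b⟩))

theorem line_lt_of_sq_le (x : HiddenStair L) (d : Bool) {n : ℕ} (hn : 4 ^ L * 4 ^ L ≤ n) :
    line (4 ^ L) (x.offset d) x.1 < n := by
  refine lt_of_lt_of_le ?_ hn
  have h1 := x.offset_lt d x.1
  have h2 : ((x.1 : ℕ) + 1) * 4 ^ L ≤ 4 ^ L * 4 ^ L := Nat.mul_le_mul_right _ x.1.2
  unfold line
  rw [add_mul] at h2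
  omega

/-- The herringbone map as a self-map of the grid; the coordinates after the first two are
mapped to `0`. -/
def gridMap (x : HiddenStair L) {n k : ℕ} (hn : 0 < n) (hk : 2 ≤ k) (z : Grid n k) : Grid n k :=
  fun i =>
    if (i : ℕ) = 0 then
      ⟨min (x.imageX (z ⟨0, by omega⟩) (z ⟨1, by omega⟩)) (n - 1), by omega⟩
    else if (i : ℕ) = 1 then
      ⟨min (x.imageY (z ⟨0, by omega⟩) (z ⟨1, by omega⟩)) (n - 1), by omega⟩
    else ⟨0, hn⟩

theorem gridMap_mono (x : HiddenStair L) {n k : ℕ} (hn : 0 < n) (hk : 2 ≤ k) :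
    Monotone (x.gridMap hn hk) := by
  intro z z' h i
  have h0 : (z ⟨0, by omega⟩ : ℕ) ≤ z' ⟨0, by omega⟩ := h _
  have h1 : (z ⟨1, by omega⟩ : ℕ) ≤ z' ⟨1, by omega⟩ := h _
  unfold gridMap
  split_ifs
  · exact min_le_min_right _ (moveX_mono x.heights_mono _ h0 h1)
  · exact min_le_min_right _ (moveY_mono x.heights_mono _ h0 h1)
  · exact le_rfl

theorem eq_line_of_mem_fixedPoints (x : HiddenStair L) {n k : ℕ} (hn : 0 < n) (hk : 2 ≤ k)
    (hL : 4 ^ L * 4 ^ L ≤ n) {z : Grid n k} (hz : z ∈ Function.fixedPoints (x.gridMap hn hk)) :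
    (z ⟨0, by omega⟩ : ℕ) = line (4 ^ L) (x.offset true) x.1 := by
  have hz' : x.gridMap hn hk z = z := hz
  have h0 := congrArg (fun v : Grid n k => (v ⟨0, by omega⟩ : ℕ)) hz'
  have h1 := congrArg (fun v : Grid n k => (v ⟨1, by omega⟩ : ℕ)) hz'
  simp only [gridMap, if_true, one_ne_zero, if_false] at h0 h1
  refine eq_of_move_eq x.heights_mono (x.line_lt_of_sq_le true hL) (x.line_lt_of_sq_le false hL)
    (Fin.isLt _) (stair_line (x.offset_lt true) _).le ?_ h0 h1
  rw [← stair_line (v := x.offset false) (x.offset_lt true) x.1]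
  exact x.heights_mono (Nat.le_succ _)

/-- Dividing the first coordinate of a fixed point by the strip width recovers the hidden strip. -/
theorem disjoint_fixedPoints {x y : HiddenStair L} (hxy : x.1 ≠ y.1) {n k : ℕ} (hn : 0 < n)
    (hk : 2 ≤ k) (hL : 4 ^ L * 4 ^ L ≤ n) :
    Disjoint (Function.fixedPoints (x.gridMap hn hk)) (Function.fixedPoints (y.gridMap hn hk)) := by
  refine Set.disjoint_left.2 fun z hx hy => hxy (Fin.ext ?_)
  have h1 := eq_line_of_mem_fixedPoints x hn hk hL hx
  rw [eq_line_of_mem_fixedPoints y hn hk hL hy] at h1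
  rw [← line_div (x.offset_lt true x.1), ← h1, line_div (y.offset_lt true y.1)]

theorem gridMap_eq_of_not_detects {x y : HiddenStair L} (hxy : kernel x y ≠ 0) {n k : ℕ}
    (hn : 0 < n) (hk : 2 ≤ k) (z : Grid n k) (hp : ¬Detects x y true (z ⟨0, by omega⟩))
    (hq : ¬Detects x y false (z ⟨1, by omega⟩)) : x.gridMap hn hk z = y.gridMap hn hk z := by
  obtain ⟨h1, h2⟩ := image_eq_of_not_detects hxy hp hq
  funext i
  simp only [gridMap, h1, h2]

open Classical in
theorem quadraticForm_detects_le (d : Bool) (p : ℕ) (w : HiddenStair L → ℝ) :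
    ∑ x : HiddenStair L, ∑ y, (if Detects x y d p then kernel x y else 0) * (w x * w y) ≤
      9 / (L + 1) * ∑ x, w x ^ 2 := by
  by_cases h : p / 4 ^ L < 4 ^ L
  · refine le_trans (le_of_eq ?_) (quadraticForm_kernelAt_le (⟨p / 4 ^ L, h⟩, d)
      ⟨p % 4 ^ L, Nat.mod_lt _ (by positivity)⟩ w)
    refine Finset.sum_congr rfl fun x _ => Finset.sum_congr rfl fun y _ => ?_
    simp only [Detects, kernelAt, h, exists_true_left]
  · simp only [Detects, h, IsEmpty.exists_iff, if_false, zero_mul, Finset.sum_const_zero]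
    positivity

/-- A union bound over the two directions: entrywise domination passes to the quadratic forms
because `w` is nonnegative. -/
theorem quadraticForm_gridMap_le {n k : ℕ} (hn : 0 < n) (hk : 2 ≤ k) {b : ℕ}
    (enc : Grid n k ↪ (Fin b → Bool)) (z : Grid n k) (w : HiddenStair L → ℝ)
    (hw : ∀ x, 0 ≤ w x) :
    ∑ x : HiddenStair L, ∑ y : HiddenStair L,
      (if enc (x.gridMap hn hk z) = enc (y.gridMap hn hk z) then 0 else kernel x y) *
        (w x * w y) ≤ 18 / (L + 1) * ∑ x, w x ^ 2 := by
  classical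
  have h1 := quadraticForm_detects_le (L := L) true (z ⟨0, by omega⟩) w
  have h2 := quadraticForm_detects_le (L := L) false (z ⟨1, by omega⟩) w
  have h3 : ∀ x y : HiddenStair L,
      (if enc (x.gridMap hn hk z) = enc (y.gridMap hn hk z) then 0 else kernel x y) *
        (w x * w y) ≤
      (if Detects x y true (z ⟨0, by omega⟩) then kernel x y else 0) * (w x * w y) +
      (if Detects x y false (z ⟨1, by omega⟩) then kernel x y else 0) * (w x * w y) := by
    intro x y
    rw [← add_mul]
    refine mul_le_mul_of_nonneg_right ?_ (mul_nonneg (hw x) (hw y))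
    have h0 := kernel_nonneg x y
    rcases eq_or_ne (kernel x y) 0 with he | hne
    · simp [he]
    by_cases hp : Detects x y true (z ⟨0, by omega⟩)
    · rw [if_pos hp]
      split_ifs <;> linarith
    by_cases hq : Detects x y false (z ⟨1, by omega⟩)
    · rw [if_neg hp, if_pos hq]
      split_ifs <;> linarith
    · rw [if_neg hp, if_neg hq, if_pos (by rw [gridMap_eq_of_not_detects hne hn hk z hp hq])]
      simp
  have h4 := Finset.sum_le_sum fun x (_ : x ∈ Finset.univ) =>
    Finset.sum_le_sum fun y (_ : y ∈ Finset.univ) => h3 x y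
  simp only [Finset.sum_add_distrib] at h4
  have h5 : (18 : ℝ) / (L + 1) = 9 / (L + 1) + 9 / (L + 1) := by ring
  rw [h5, add_mul]
  linarith

end HiddenStair

/-! ### The lower bound -/

theorem QueryAlgorithm.queries_ge_of_succeeds {n k b : ℕ} (L : ℕ) (hk : 2 ≤ k)
    (hL : 4 ^ L * 4 ^ L ≤ n) (enc : Grid n k ↪ (Fin b → Bool))
    (A : QueryAlgorithm (Grid n k) b (Grid n k))
    (hA : A.Succeeds enc {f : Grid n k → Grid n k | Monotone f}
      (fun f => Function.fixedPoints f)) :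
    (L : ℝ) * (L + 1) / 864 ≤ A.queries := by
  have hn : 0 < n := lt_of_lt_of_le (by positivity) hL
  have h := A.sum_le_of_quadraticForm_le
    (fun (x : HiddenStair L) z => enc (x.gridMap hn hk z))
    (fun x => Function.fixedPoints (x.gridMap hn hk))
    (fun x => hA _ (x.gridMap_mono hn hk)) HiddenStair.kernel HiddenStair.kernel_nonneg
    (fun x y hxy => HiddenStair.disjoint_fixedPoints
      (HiddenStair.fst_ne_of_kernel_ne_zero hxy) hn hk hL)
    (18 / (L + 1)) (HiddenStair.quadraticForm_gridMap_le hn hk enc)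
  have h2 := (HiddenStair.sum_kernel_ge L).trans h
  have hc : (0 : ℝ) < Fintype.card (HiddenStair L) := by
    have : Nonempty (HiddenStair L) := ⟨⟨⟨0, by positivity⟩, fun _ => ⟨0, by positivity⟩⟩⟩
    exact_mod_cast Fintype.card_pos
  have h3 : 3 / 4 * (L : ℝ) ≤ 36 * (18 / (L + 1)) * A.queries := by
    refine le_of_mul_le_mul_right ?_ hc
    linarith
  have hL1 : (0 : ℝ) < L + 1 := by positivity
  have h4 : 36 * (18 / ((L : ℝ) + 1)) * A.queries = 648 * A.queries / (L + 1) := by ring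
  rw [h4, le_div_iff₀ hL1] at h3
  linarith

theorem corollary2 :
    ∃ c : ℝ, 0 < c ∧ ∃ N : ℕ, ∀ k : ℕ, 2 ≤ k → ∀ n : ℕ, N ≤ n →
      ∀ (b : ℕ) (enc : Grid n k ↪ (Fin b → Bool)),
        ENNReal.ofReal (c * Real.log (n : ℝ) ^ 2) ≤
          ((tarskiQueryComplexity n k enc : ℕ∞) : ℝ≥0∞) := by
  -- The staircase needs side `4 ^ L * 4 ^ L = 16 ^ L`. From `16 ≤ n` comes `1 ≤ L`, hence `(L + 1)
  -- ^ 2 ≤ 2 * L * (L + 1)`, and `1728 = 2 * 864`.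
  refine ⟨1 / (1728 * Real.log 16 ^ 2), by positivity, 16, fun k hk n hn b enc => ?_⟩
  set L := Nat.log 16 n with hLdef
  have hL : 4 ^ L * 4 ^ L ≤ n := by
    rw [← mul_pow]
    exact Nat.pow_log_le_self 16 (by omega)
  have hL1 : 1 ≤ L := Nat.le_log_of_pow_le (by norm_num) (by simpa using hn)
  have hlog : Real.log n ≤ (L + 1) * Real.log 16 := by
    have h1 : n < 16 ^ (L + 1) := Nat.lt_pow_succ_log_self (by norm_num) n
    have h2 : (n : ℝ) ≤ 16 ^ (L + 1) := by exact_mod_cast h1.le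
    have h3 := Real.log_le_log (by exact_mod_cast (by omega : 0 < n)) h2
    rw [Real.log_pow] at h3
    exact_mod_cast h3
  have hl16 : 0 < Real.log 16 := Real.log_pos (by norm_num)
  have hbound : 1 / (1728 * Real.log 16 ^ 2) * Real.log n ^ 2 ≤ (L : ℝ) * (L + 1) / 864 := by
    have h0 : 0 ≤ Real.log n := Real.log_natCast_nonneg n
    have h1 : Real.log n ^ 2 ≤ ((L + 1) * Real.log 16) ^ 2 := pow_le_pow_left₀ h0 hlog 2
    have h2 : (1 : ℝ) ≤ L := by exact_mod_cast hL1
    calc _ ≤ 1 / (1728 * Real.log 16 ^ 2) * ((L + 1) * Real.log 16) ^ 2 :=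
          mul_le_mul_of_nonneg_left h1 (by positivity)
      _ = (L + 1) * (L + 1) / 1728 := by field_simp
      _ ≤ _ := by nlinarith
  have hceil : ((⌈1 / (1728 * Real.log 16 ^ 2) * Real.log n ^ 2⌉₊ : ℕ) : ℕ∞) ≤
      tarskiQueryComplexity n k enc := by
    refine le_iInf₂ fun A hA => ?_
    exact_mod_cast Nat.ceil_le.2 (hbound.trans (A.queries_ge_of_succeeds L hk hL enc hA))
  calc _ ≤ ENNReal.ofReal (⌈1 / (1728 * Real.log 16 ^ 2) * Real.log n ^ 2⌉₊ : ℕ) :=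
        ENNReal.ofReal_le_ofReal (Nat.le_ceil _)
    _ = (((⌈1 / (1728 * Real.log 16 ^ 2) * Real.log n ^ 2⌉₊ : ℕ) : ℕ∞) : ℝ≥0∞) := by
        rw [ENNReal.ofReal_natCast, ENat.toENNReal_coe]
    _ ≤ _ := ENat.toENNReal_mono hceil
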